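/- Let $V=\{1,\dots,n\}$ and let $s\in[0,1]^n$ be a vector of innate opinions. For a weighted undirected graph $G=(V,E,w)$ (no loops, $w_{uv}=w_{vu}>0$ exactly on the edges) let $L$ be its combinatorial Laplacian, let $z^*=(I+L)^{-1}s$ be the Friedkin–Johnsen equilibrium, and let $\bar z=z^*-\frac{\vec 1^{T}z^*}{n}\vec 1$. The polarization-disagreement index of $G$ is $$\mathcal I_{G,s}=\sum_{u\in V}\bar z_u^2+\sum_{\{u,v\}\in E}w_{uv}(z^*_u-z^*_v)^2 .$$ For a real number $m$, let $\mathcal G_{n,m}$ be the set of connected weighted graphs on $V$ with total edge weight $\sum_{\{u,v\}\in E}w_{uv}=m$, and let $\mathrm{OPT}=\inf_{G\in\mathcal G_{n,m}}\mathcal I_{G,s}$. There are absolute constants $C,K>0$ such that for all $n$, all $m$ for which $\mathcal G_{n,m}$ is nonempty (that is, $n\ge 2$ and $m>0$, or $n=1$ and $m=0$), all $s\in[0,1]^n$ and all $\varepsilon\in(0,1)$, there is a graph $H\in\mathcal G_{n,m}$ with at most $C\,n/\varepsilon^2$ edges such that $$\mathrm{OPT}\le \mathcal I_{H,s}\le (1+\varepsilon+K\varepsilon^2)\,\mathrm{OPT}.$$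 -/

import Mathlib

/-- A weighted undirected graph `G(V, E, w)`: a simple graph together with a symmetric weight
function that is positive on the edges and zero on the pairs that are not edges. -/
structure WeightedGraph (V : Type*) extends SimpleGraph V where
  weight : V → V → ℝ
  weight_symm : ∀ u v, weight u v = weight v u
  weight_pos : ∀ u v, Adj u v → 0 < weight u v
  weight_eq_zero : ∀ u v, ¬ Adj u v → weight u v = 0

namespace WeightedGraph

variable {V : Type*}

/-- The number of edges. -/
noncomputable def numEdges (G : WeightedGraph V) : ℕ := G.edgeSet.ncard

variable [Fintype V]

/-- The total edge weight. Each edge `{u, v}` occurs twice in the double sum. -/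
noncomputable def totalWeight (G : WeightedGraph V) : ℝ :=
  (∑ u, ∑ v, G.weight u v) / 2

/-- The combinatorial Laplacian `L = D - W`, with `D` the diagonal matrix of weighted degrees. -/
noncomputable def laplacian [DecidableEq V] (G : WeightedGraph V) : Matrix V V ℝ :=
  Matrix.diagonal (fun u => ∑ v, G.weight u v) - Matrix.of G.weight

/-- The Friedkin-Johnsen equilibrium `z* = (I + L)⁻¹ s` for the innate opinions `s`. -/
noncomputable def equilibrium [DecidableEq V] (G : WeightedGraph V) (s : V → ℝ) : V → ℝ :=
  Matrix.mulVec (1 + G.laplacian)⁻¹ s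

/-- The total disagreement: the sum of `w_uv (z*_u - z*_v)²` over all edges `{u, v}`.
Each edge occurs twice in the double sum. -/
noncomputable def disagreement [DecidableEq V] (G : WeightedGraph V) (s : V → ℝ) : ℝ :=
  (∑ u, ∑ v, G.weight u v * (G.equilibrium s u - G.equilibrium s v) ^ 2) / 2

/-- The polarization: the sum of squares of the mean-centered equilibrium opinions. -/
noncomputable def polarization [DecidableEq V] (G : WeightedGraph V) (s : V → ℝ) : ℝ :=
  ∑ u, (G.equilibrium s u - (∑ v, G.equilibrium s v) / Fintype.card V) ^ 2

/-- The polarization-disagreement index. -/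
noncomputable def pdIndex [DecidableEq V] (G : WeightedGraph V) (s : V → ℝ) : ℝ :=
  G.polarization s + G.disagreement s

end WeightedGraph

/-- The feasible set of the topology problem: the connected weighted graphs on `V` of total edge
weight `m`. -/
def feasibleGraphs (V : Type*) [Fintype V] (m : ℝ) : Set (WeightedGraph V) :=
  {G | G.Connected ∧ G.totalWeight = m}

/-- The optimal value of the topology problem: the infimum of the polarization-disagreement index
over the feasible graphs (the index is nonnegative, so it is bounded below). -/
noncomputable def optimalIndex {V : Type*} [Fintype V] [DecidableEq V] (m : ℝ) (s : V → ℝ) : ℝ :=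
  sInf ((fun G : WeightedGraph V => G.pdIndex s) '' feasibleGraphs V m)

/-! The index equals `z ⬝ᵥ s` minus a constant depending only on `s` and `n`, so it sees the graph
only through its equilibrium `z`, the solution of z + Lz = s. For fixed `z`, Lz / m is a convex
combination of the vectors (z_u - z_v)(e_u - e_v). Carathéodory's theorem in dimension n replaces it
by one with at most n + 1 terms: a graph with the same total weight, equilibrium and index
(`exists_numEdges_le_pdIndex_eq`).

That graph may be disconnected. Mixing in a little of a star of the same weight restores
connectivity with at most n more edges. The index is a maximum of functions affine in the weights,
hence convex (`pdIndex_mix_le`), so the cost is arbitrarily small. The slack that pays for it, and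
for a possibly unattained infimum, is a multiple of OPT, which is positive for nonconstant `s`
(`sq_div_le_pdIndex`); for constant `s` every index is 0. -/

namespace WeightedGraph

/-! ### Dirichlet energy, equilibrium and the variational form of the index -/

section Energy

variable {V : Type*}

theorem weight_nonneg (G : WeightedGraph V) (u v : V) : 0 ≤ G.weight u v := by
  by_cases h : G.Adj u v
  · exact (G.weight_pos u v h).le
  · exact (G.weight_eq_zero u v h).ge

theorem weight_self (G : WeightedGraph V) (u : V) : G.weight u u = 0 :=
  G.weight_eq_zero u u (G.loopless.irrefl u)

variable [Fintype V]

/-- The Dirichlet energy of `x`: the sum of `w_uv (x_u - x_v)²` over all edges `{u, v}`. -/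
noncomputable def energy (G : WeightedGraph V) (x : V → ℝ) : ℝ :=
  (∑ u, ∑ v, G.weight u v * (x u - x v) ^ 2) / 2

theorem energy_nonneg (G : WeightedGraph V) (x : V → ℝ) : 0 ≤ G.energy x := by
  have : ∀ u v, 0 ≤ G.weight u v * (x u - x v) ^ 2 := fun u v =>
    mul_nonneg (G.weight_nonneg u v) (sq_nonneg _)
  exact div_nonneg (Finset.sum_nonneg fun u _ => Finset.sum_nonneg fun v _ => this u v) zero_le_two

theorem energy_le_totalWeight (G : WeightedGraph V) (x : V → ℝ)
    (hx : ∀ u v, (x u - x v) ^ 2 ≤ 1) : G.energy x ≤ G.totalWeight := by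
  unfold energy totalWeight
  gcongr with u _ v _
  exact mul_le_of_le_one_right (G.weight_nonneg u v) (hx u v)

theorem totalWeight_nonneg (G : WeightedGraph V) : 0 ≤ G.totalWeight :=
  div_nonneg (Finset.sum_nonneg fun u _ => Finset.sum_nonneg fun v _ => G.weight_nonneg u v)
    zero_le_two

theorem totalWeight_eq_zero_of_subsingleton [Subsingleton V] (G : WeightedGraph V) :
    G.totalWeight = 0 := by
  have : ∀ u v, G.weight u v = 0 := fun u v => by rw [Subsingleton.elim v u, weight_self]
  simp [totalWeight, this]

theorem totalWeight_pos [Nontrivial V] (G : WeightedGraph V) (hG : G.Connected) :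
    0 < G.totalWeight := by
  obtain ⟨u⟩ := hG.nonempty
  obtain ⟨v, hv⟩ := hG.preconnected.exists_adj_of_nontrivial u
  have h : ∀ u v, 0 ≤ G.weight u v := G.weight_nonneg
  exact half_pos (Finset.sum_pos' (fun u _ => Finset.sum_nonneg fun v _ => h u v)
    ⟨u, Finset.mem_univ u, Finset.sum_pos' (fun v _ => h u v)
      ⟨v, Finset.mem_univ v, G.weight_pos u v hv⟩⟩)

theorem sum_sum_weight_mul_swap (G : WeightedGraph V) (f : V → V → ℝ) :
    ∑ u, ∑ v, G.weight u v * f u v = ∑ u, ∑ v, G.weight u v * f v u := by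
  rw [Finset.sum_comm]
  simp_rw [G.weight_symm]

variable [DecidableEq V]

theorem laplacian_mulVec (G : WeightedGraph V) (x : V → ℝ) (u : V) :
    (G.laplacian.mulVec x) u = ∑ v, G.weight u v * (x u - x v) := by
  rw [laplacian, Matrix.sub_mulVec, Pi.sub_apply, Matrix.mulVec_diagonal]
  simp [Matrix.mulVec, dotProduct, mul_sub, Finset.sum_mul]

theorem dotProduct_laplacian_mulVec (G : WeightedGraph V) (x y : V → ℝ) :
    x ⬝ᵥ G.laplacian.mulVec y = (∑ u, ∑ v, G.weight u v * ((x u - x v) * (y u - y v))) / 2 := by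
  have h : x ⬝ᵥ G.laplacian.mulVec y = ∑ u, ∑ v, G.weight u v * (x u * (y u - y v)) := by
    simp only [dotProduct, laplacian_mulVec, Finset.mul_sum]
    exact Finset.sum_congr rfl fun u _ => Finset.sum_congr rfl fun v _ => by ring
  have h' := h.trans (G.sum_sum_weight_mul_swap fun u v => x u * (y u - y v))
  rw [eq_div_iff two_ne_zero, mul_two]
  nth_rw 1 [h]
  rw [h']
  simp only [← Finset.sum_add_distrib]
  exact Finset.sum_congr rfl fun u _ => Finset.sum_congr rfl fun v _ => by ring

theorem dotProduct_laplacian_self (G : WeightedGraph V) (x : V → ℝ) :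
    x ⬝ᵥ G.laplacian.mulVec x = G.energy x := by
  simp only [dotProduct_laplacian_mulVec, energy, sq]

theorem dotProduct_laplacian_comm (G : WeightedGraph V) (x y : V → ℝ) :
    x ⬝ᵥ G.laplacian.mulVec y = y ⬝ᵥ G.laplacian.mulVec x := by
  simp only [dotProduct_laplacian_mulVec, mul_comm (x _ - x _)]

theorem isUnit_one_add_laplacian (G : WeightedGraph V) : IsUnit (1 + G.laplacian) := by
  rw [← Matrix.mulVec_injective_iff_isUnit]
  refine (injective_iff_map_eq_zero (1 + G.laplacian).mulVecLin).2 fun x hx => ?_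
  have hx : x + G.laplacian.mulVec x = 0 := by
    simpa [Matrix.add_mulVec] using hx
  have h : x ⬝ᵥ x + G.energy x = 0 := by
    rw [← dotProduct_laplacian_self, ← dotProduct_add, hx, dotProduct_zero]
  have h0 : 0 ≤ x ⬝ᵥ x := Finset.sum_nonneg fun u _ => mul_self_nonneg (x u)
  have := G.energy_nonneg x
  exact dotProduct_self_eq_zero.1 (by linarith)

theorem equilibrium_add_laplacian_mulVec (G : WeightedGraph V) (s : V → ℝ) :
    G.equilibrium s + G.laplacian.mulVec (G.equilibrium s) = s := by
  have h := (Matrix.isUnit_iff_isUnit_det _).1 G.isUnit_one_add_laplacian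
  have : (1 + G.laplacian).mulVec (G.equilibrium s) = s := by
    rw [equilibrium, Matrix.mulVec_mulVec, Matrix.mul_nonsing_inv _ h, Matrix.one_mulVec]
  simpa [Matrix.add_mulVec] using this

theorem equilibrium_eq_of_add_laplacian_mulVec (G : WeightedGraph V) {s z : V → ℝ}
    (hz : z + G.laplacian.mulVec z = s) : G.equilibrium s = z := by
  have h := (Matrix.isUnit_iff_isUnit_det _).1 G.isUnit_one_add_laplacian
  have hz : (1 + G.laplacian).mulVec z = s := by simpa [Matrix.add_mulVec] using hz
  rw [equilibrium, ← hz, Matrix.mulVec_mulVec, Matrix.nonsing_inv_mul _ h, Matrix.one_mulVec]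

theorem equilibrium_dotProduct (G : WeightedGraph V) (s : V → ℝ) :
    G.equilibrium s ⬝ᵥ s =
      G.equilibrium s ⬝ᵥ G.equilibrium s + G.energy (G.equilibrium s) := by
  conv_lhs => rw [← G.equilibrium_add_laplacian_mulVec s]
  rw [G.equilibrium_add_laplacian_mulVec s]
  rw [← dotProduct_laplacian_self, ← dotProduct_add, G.equilibrium_add_laplacian_mulVec s]

theorem sum_equilibrium (G : WeightedGraph V) (s : V → ℝ) :
    ∑ u, G.equilibrium s u = ∑ u, s u := by
  have h : (1 : V → ℝ) ⬝ᵥ G.laplacian.mulVec (G.equilibrium s) = 0 := by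
    simp [dotProduct_laplacian_mulVec]
  have h' := congrArg (fun t => (1 : V → ℝ) ⬝ᵥ t) (G.equilibrium_add_laplacian_mulVec s)
  simp only [dotProduct_add, h, add_zero, one_dotProduct] at h'
  exact h'


/-- Since L annihilates constants, `z` and `s` have the same mean; pairing z + Lz = s with `z` gives
the rest. -/
theorem pdIndex_eq_dotProduct (G : WeightedGraph V) (s : V → ℝ) :
    G.pdIndex s = G.equilibrium s ⬝ᵥ s - (∑ u, s u) ^ 2 / Fintype.card V := by
  have h : G.polarization s =
      G.equilibrium s ⬝ᵥ G.equilibrium s - (∑ u, s u) ^ 2 / Fintype.card V := by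
    rw [polarization, sum_equilibrium]
    simp only [sub_sq, Finset.sum_add_distrib, Finset.sum_sub_distrib, ← Finset.sum_mul,
      ← Finset.mul_sum, sum_equilibrium, Finset.sum_const, Finset.card_univ, nsmul_eq_mul,
      dotProduct, ← sq]
    by_cases hV : (Fintype.card V : ℝ) = 0
    · simp [hV]
    · field_simp
      ring
  rw [pdIndex, h, equilibrium_dotProduct]
  simp only [energy, disagreement]
  ring

/-- The variational characterization of the index: `s ⬝ᵥ (I + L)⁻¹ s` is the maximum of the
concave function `x ↦ 2 x ⬝ᵥ s - x ⬝ᵥ x - energy x`. -/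
theorem le_equilibrium_dotProduct (G : WeightedGraph V) (s x : V → ℝ) :
    2 * (x ⬝ᵥ s) - x ⬝ᵥ x - G.energy x ≤ G.equilibrium s ⬝ᵥ s := by
  set z := G.equilibrium s
  have h1 : x ⬝ᵥ s = x ⬝ᵥ z + x ⬝ᵥ G.laplacian.mulVec z := by
    rw [← dotProduct_add, G.equilibrium_add_laplacian_mulVec s]
  have h2 : z ⬝ᵥ s = z ⬝ᵥ z + G.energy z := G.equilibrium_dotProduct s
  -- The gap between the two sides is |x - z|² plus the energy of x - z.
  have h3 : 0 ≤ (x - z) ⬝ᵥ (x - z) := Finset.sum_nonneg fun u _ => mul_self_nonneg _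
  have h4 := G.energy_nonneg (x - z)
  rw [← dotProduct_laplacian_self, Matrix.mulVec_sub] at h4
  simp only [dotProduct_sub, sub_dotProduct, dotProduct_laplacian_self,
    G.dotProduct_laplacian_comm z x] at h3 h4
  rw [dotProduct_comm z x] at h3
  linarith

theorem pdIndex_nonneg (G : WeightedGraph V) (s : V → ℝ) : 0 ≤ G.pdIndex s :=
  add_nonneg (Finset.sum_nonneg fun _ _ => sq_nonneg _) (G.energy_nonneg (G.equilibrium s))

theorem pdIndex_eq_zero_of_const (G : WeightedGraph V) (c : ℝ) : G.pdIndex (fun _ => c) = 0 := by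
  have h : G.equilibrium (fun _ => c) = fun _ => c := by
    apply equilibrium_eq_of_add_laplacian_mulVec
    ext u
    simp [laplacian_mulVec]
  rw [pdIndex_eq_dotProduct, h]
  simp only [dotProduct, Finset.sum_const, Finset.card_univ, nsmul_eq_mul]
  by_cases hV : (Fintype.card V : ℝ) = 0
  · simp [hV]
  · field_simp
    ring

/-- The index is bounded below in terms of the variance of the opinions and the total weight. -/
theorem sq_div_le_pdIndex [Nonempty V] (G : WeightedGraph V) (s : V → ℝ)
    (hs : ∀ u v, (s u - s v) ^ 2 ≤ 1) {A : ℝ}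
    (hA : A = ∑ u, (s u - (∑ v, s v) / Fintype.card V) ^ 2) (hA0 : 0 < A) :
    A ^ 2 / (A + G.totalWeight) ≤ G.pdIndex s := by
  have hV : (Fintype.card V : ℝ) ≠ 0 := by exact_mod_cast Fintype.card_ne_zero
  set μ := (∑ v, s v) / Fintype.card V with hμ
  -- This `t` maximizes 2tA - t²(A + m), the bound given by the test vector μ + t(s - μ) when the
  -- energy of `s` is at most m.
  set t := A / (A + G.totalWeight) with ht
  have hm := G.totalWeight_nonneg
  have hsum : ∑ v, s v = Fintype.card V * μ := by rw [hμ]; field_simp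
  have hy : ∑ u, (s u - μ) = 0 := by
    simp [Finset.sum_sub_distrib, hsum]
  have h := G.le_equilibrium_dotProduct s (fun u => μ + t * (s u - μ))
  have hE : G.energy (fun u => μ + t * (s u - μ)) = t ^ 2 * G.energy s := by
    simp only [energy, ← mul_div_assoc, Finset.mul_sum]
    congr 1
    exact Finset.sum_congr rfl fun u _ => Finset.sum_congr rfl fun v _ => by ring
  have h1 : (fun u => μ + t * (s u - μ)) ⬝ᵥ s = Fintype.card V * μ ^ 2 + t * A := by
    have : ∀ u, (μ + t * (s u - μ)) * s u =
        μ ^ 2 + (μ + t * μ) * (s u - μ) + t * (s u - μ) ^ 2 := fun u => by ring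
    simp only [dotProduct, this, Finset.sum_add_distrib, ← Finset.mul_sum, hy, ← hA]
    simp
  have h2 : (fun u => μ + t * (s u - μ)) ⬝ᵥ (fun u => μ + t * (s u - μ)) =
      Fintype.card V * μ ^ 2 + t ^ 2 * A := by
    have : ∀ u, (μ + t * (s u - μ)) * (μ + t * (s u - μ)) =
        μ ^ 2 + (2 * μ * t) * (s u - μ) + t ^ 2 * (s u - μ) ^ 2 := fun u => by ring
    simp only [dotProduct, this, Finset.sum_add_distrib, ← Finset.mul_sum, hy, ← hA]
    simp
  have h3 : t ^ 2 * G.energy s ≤ t ^ 2 * G.totalWeight :=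
    mul_le_mul_of_nonneg_left (G.energy_le_totalWeight s hs) (sq_nonneg t)
  have h4 : (∑ u, s u) ^ 2 / Fintype.card V = Fintype.card V * μ ^ 2 := by
    rw [hsum]; field_simp
  have h5 : A ^ 2 / (A + G.totalWeight) = 2 * (t * A) - t ^ 2 * A - t ^ 2 * G.totalWeight := by
    have : A + G.totalWeight ≠ 0 := by positivity
    rw [ht]; field_simp; ring
  rw [pdIndex_eq_dotProduct, h4, h5]
  rw [hE, h1, h2] at h
  linarith

end Energy

/-! ### Convex combinations of graphs -/

section Mix

variable {V : Type*}

/-- The convex combination `(1 - t) G + t T` of two weighted graphs. -/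
def mix (G T : WeightedGraph V) (t : ℝ) (h0 : 0 < t) (h1 : t < 1) : WeightedGraph V where
  toSimpleGraph := G.toSimpleGraph ⊔ T.toSimpleGraph
  weight u v := (1 - t) * G.weight u v + t * T.weight u v
  weight_symm u v := by rw [G.weight_symm, T.weight_symm]
  weight_pos u v h := by
    have hG := mul_nonneg (sub_pos.2 h1).le (G.weight_nonneg u v)
    have hT := mul_nonneg h0.le (T.weight_nonneg u v)
    rcases h with h | h
    · exact add_pos_of_pos_of_nonneg (mul_pos (sub_pos.2 h1) (G.weight_pos u v h)) hT
    · exact add_pos_of_nonneg_of_pos hG (mul_pos h0 (T.weight_pos u v h))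
  weight_eq_zero u v h := by
    rw [SimpleGraph.sup_adj, not_or] at h
    rw [G.weight_eq_zero u v h.1, T.weight_eq_zero u v h.2]
    ring

variable (G T : WeightedGraph V) {t : ℝ} (h0 : 0 < t) (h1 : t < 1)

theorem mix_connected (hT : T.Connected) : (mix G T t h0 h1).Connected :=
  hT.mono (le_sup_right : T.toSimpleGraph ≤ G.toSimpleGraph ⊔ T.toSimpleGraph)

theorem numEdges_mix_le : (mix G T t h0 h1).numEdges ≤ G.numEdges + T.numEdges := by
  have : (mix G T t h0 h1).edgeSet = G.edgeSet ∪ T.edgeSet := SimpleGraph.edgeSet_sup _ _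
  rw [numEdges, this]
  exact Set.ncard_union_le _ _

variable [Fintype V]

theorem totalWeight_mix :
    (mix G T t h0 h1).totalWeight = (1 - t) * G.totalWeight + t * T.totalWeight := by
  simp only [totalWeight, mix, Finset.sum_add_distrib, ← Finset.mul_sum]
  ring

theorem energy_mix (x : V → ℝ) :
    (mix G T t h0 h1).energy x = (1 - t) * G.energy x + t * T.energy x := by
  simp only [energy, mix, add_mul, mul_assoc, Finset.sum_add_distrib, ← Finset.mul_sum]
  ring

/-- The index is a convex function of the weights. -/
theorem pdIndex_mix_le [DecidableEq V] (s : V → ℝ) :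
    (mix G T t h0 h1).pdIndex s ≤ (1 - t) * G.pdIndex s + t * T.pdIndex s := by
  have h := (mix G T t h0 h1).equilibrium_dotProduct s
  simp only [pdIndex_eq_dotProduct]
  -- The maximizer for the mixture is a competitor for `G` and for `T`, and the energy is affine in
  -- the weights.
  set z := (mix G T t h0 h1).equilibrium s
  have hG := mul_le_mul_of_nonneg_left (G.le_equilibrium_dotProduct s z) (sub_pos.2 h1).le
  have hT := mul_le_mul_of_nonneg_left (T.le_equilibrium_dotProduct s z) h0.le
  rw [energy_mix] at h
  linarith

end Mix

/-! ### Stars as sparse connected graphs -/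

section Star

variable {V : Type*} [DecidableEq V]

/-- The star with center `r` and all edges of weight `a`. -/
def star (r : V) (a : ℝ) (ha : 0 < a) : WeightedGraph V where
  Adj u v := u ≠ v ∧ (u = r ∨ v = r)
  symm := ⟨fun _ _ h => ⟨h.1.symm, h.2.symm⟩⟩
  loopless := ⟨fun _ h => h.1 rfl⟩
  weight u v := if u ≠ v ∧ (u = r ∨ v = r) then a else 0
  weight_symm u v := by simp only [ne_comm, or_comm]
  weight_pos u v h := by rwa [if_pos h]
  weight_eq_zero u v h := if_neg h

variable (r : V) {a : ℝ} (ha : 0 < a)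

theorem star_connected : (star r a ha).Connected := by
  have h : ∀ v, (star r a ha).Reachable r v := fun v => by
    by_cases hv : r = v
    · rw [hv]
    · exact SimpleGraph.Adj.reachable ⟨hv, Or.inl rfl⟩
  exact (SimpleGraph.connected_iff _).2 ⟨fun u v => (h u).symm.trans (h v), ⟨r⟩⟩

variable [Fintype V]

theorem totalWeight_star : (star r a ha).totalWeight = (Fintype.card V - 1) * a := by
  -- The last term removes the loop at `r`, which both indicators count.
  have h : ∀ u v : V, (star r a ha).weight u v =
      (if u = r then a else 0) + (if v = r then a else 0) -
        (if u = r then if v = r then 2 * a else 0 else 0) := by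
    intro u v
    by_cases hu : u = r <;> by_cases hv : v = r <;> simp [star, hu, hv, two_mul]
    exact fun h => absurd h.symm hv
  simp only [totalWeight, h, Finset.sum_add_distrib, Finset.sum_sub_distrib]
  simp [Finset.sum_ite_eq']
  ring

theorem numEdges_star_le : (star r a ha).numEdges ≤ Fintype.card V := by
  have h : (star r a ha).edgeSet ⊆ Set.range fun v => s(r, v) := by
    intro e
    induction e with | _ u v =>
    rintro ⟨-, rfl | rfl⟩
    · exact ⟨v, rfl⟩
    · exact ⟨u, Sym2.eq_swap⟩
  refine (Set.ncard_le_ncard h (Set.finite_range _)).trans ?_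
  rw [← Set.image_univ, ← Nat.card_eq_fintype_card, ← Set.ncard_univ]
  exact Set.ncard_image_le

end Star

/-! ### Sparsification by Carathéodory's theorem -/

section Sparsify

variable {V : Type*} [DecidableEq V] {ι : Type*} [Fintype ι]

/-- The weighted graph with weight `a i` on the edge with end points `e i`, weights of repeated
edges being added. -/
noncomputable def ofEdges (e : ι → V × V) (he : ∀ i, (e i).1 ≠ (e i).2) (a : ι → ℝ)
    (ha : ∀ i, 0 < a i) : WeightedGraph V where
  Adj u v := ∃ i, e i = (u, v) ∨ e i = (v, u)
  symm := ⟨fun _ _ ⟨i, h⟩ => ⟨i, h.symm⟩⟩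
  loopless := ⟨fun u ⟨i, h⟩ => he i (by rcases h with h | h <;> rw [h])⟩
  weight u v := ∑ i, ((if e i = (u, v) then a i else 0) + if e i = (v, u) then a i else 0)
  weight_symm u v := by simp only [add_comm]
  weight_pos u v := by
    rintro ⟨i, h⟩
    have hn : ∀ (j : ι) (p : V × V), 0 ≤ if e j = p then a j else 0 := fun j p => by
      split_ifs
      exacts [(ha j).le, le_rfl]
    refine Finset.sum_pos' (fun j _ => add_nonneg (hn j _) (hn j _)) ⟨i, Finset.mem_univ i, ?_⟩
    rcases h with h | h
    · exact add_pos_of_pos_of_nonneg (by rw [if_pos h]; exact ha i) (hn i _)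
    · exact add_pos_of_nonneg_of_pos (hn i _) (by rw [if_pos h]; exact ha i)
  weight_eq_zero u v h := by
    rw [not_exists] at h
    exact Finset.sum_eq_zero fun i _ => by
      rw [if_neg fun h' => h i (Or.inl h'), if_neg fun h' => h i (Or.inr h'), add_zero]

variable (e : ι → V × V) (he : ∀ i, (e i).1 ≠ (e i).2) (a : ι → ℝ) (ha : ∀ i, 0 < a i)

theorem numEdges_ofEdges_le : (ofEdges e he a ha).numEdges ≤ Fintype.card ι := by
  have h : (ofEdges e he a ha).edgeSet ⊆ Set.range fun i => s((e i).1, (e i).2) := by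
    intro x
    induction x with | _ u v =>
    rintro ⟨i, h | h⟩
    · exact ⟨i, by simp only [h]⟩
    · exact ⟨i, by simp only [h]; exact Sym2.eq_swap⟩
  refine (Set.ncard_le_ncard h (Set.finite_range _)).trans ?_
  rw [← Set.image_univ, ← Nat.card_eq_fintype_card, ← Set.ncard_univ]
  exact Set.ncard_image_le

variable [Fintype V]

theorem sum_sum_weight_ofEdges_mul (f : V → V → ℝ) (hf : ∀ u v, f u v = f v u) :
    ∑ u, ∑ v, (ofEdges e he a ha).weight u v * f u v = 2 * ∑ i, a i * f (e i).1 (e i).2 := by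
  have h : ∀ i, ∑ u, ∑ v, (if e i = (u, v) then a i else 0) * f u v =
      a i * f (e i).1 (e i).2 := fun i => by
    rw [← Fintype.sum_prod_type' (f := fun u v => (if e i = (u, v) then a i else 0) * f u v)]
    simp
  have h' : ∀ i, ∑ u, ∑ v, (if e i = (v, u) then a i else 0) * f u v =
      a i * f (e i).1 (e i).2 := fun i => by
    rw [Finset.sum_comm, ← h i]
    simp only [hf]
  calc ∑ u, ∑ v, (ofEdges e he a ha).weight u v * f u v
      = ∑ u, ∑ v, ∑ i, ((if e i = (u, v) then a i else 0) * f u v +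
          (if e i = (v, u) then a i else 0) * f u v) := by
        simp only [ofEdges, Finset.sum_mul, add_mul]
    _ = ∑ i, ∑ u, ∑ v, ((if e i = (u, v) then a i else 0) * f u v +
          (if e i = (v, u) then a i else 0) * f u v) := by
        rw [Finset.sum_comm_cycle]
    _ = 2 * ∑ i, a i * f (e i).1 (e i).2 := by
        simp only [Finset.sum_add_distrib, h, h', two_mul]

/-- The contribution of the edge `{u, v}`, at unit weight, to the vector `L z`. -/
def edgeVector (z : V → ℝ) (p : V × V) : V → ℝ :=
  (z p.1 - z p.2) • (Pi.single p.1 1 - Pi.single p.2 1)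

theorem laplacian_mulVec_eq_sum (G : WeightedGraph V) (z : V → ℝ) (x : V) :
    G.laplacian.mulVec z x = (∑ u, ∑ v, G.weight u v * edgeVector z (u, v) x) / 2 := by
  have h := G.dotProduct_laplacian_mulVec (Pi.single x 1) z
  rw [single_one_dotProduct] at h
  rw [h]
  congr 1
  refine Finset.sum_congr rfl fun u _ => Finset.sum_congr rfl fun v _ => ?_
  simp only [edgeVector, Pi.smul_apply, Pi.sub_apply, smul_eq_mul, Pi.single_apply, eq_comm]
  ring

/-- By Carathéodory's theorem, some graph with at most `n + 1` edges has the same total weight and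
the same equilibrium as `G`, hence the same index. -/
theorem exists_numEdges_le_pdIndex_eq (G : WeightedGraph V) (hG : 0 < G.totalWeight)
    (s : V → ℝ) : ∃ H : WeightedGraph V, H.totalWeight = G.totalWeight ∧
      H.numEdges ≤ Fintype.card V + 1 ∧ H.pdIndex s = G.pdIndex s := by
  set z := G.equilibrium s with hz
  set m := G.totalWeight with hm
  -- The coefficients are w_uv / (2m), since ordered pairs count each edge twice.
  have hmem : m⁻¹ • G.laplacian.mulVec z ∈
      convexHull ℝ (edgeVector z '' {p | p.1 ≠ p.2}) := by
    have hfilter : ∀ f : V × V → ℝ,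
        ∑ p : V × V with p.1 ≠ p.2, G.weight p.1 p.2 / (2 * m) * f p =
          (∑ u, ∑ v, G.weight u v * f (u, v)) / (2 * m) := fun f => by
      rw [Finset.sum_filter_of_ne, Fintype.sum_prod_type, Finset.sum_div]
      · simp only [Finset.sum_div, div_mul_eq_mul_div]
      · intro p _ hp h
        simp [h, weight_self] at hp
    have hsum : ∑ p : V × V with p.1 ≠ p.2, G.weight p.1 p.2 / (2 * m) = 1 := by
      have := hfilter 1
      simp only [Pi.one_apply, mul_one] at this
      rw [this, div_eq_one_iff_eq (by positivity), hm, totalWeight]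
      ring
    have hval : m⁻¹ • G.laplacian.mulVec z =
        ∑ p : V × V with p.1 ≠ p.2, (G.weight p.1 p.2 / (2 * m)) • edgeVector z p := by
      ext x
      simp only [Pi.smul_apply, Finset.sum_apply, smul_eq_mul]
      rw [hfilter fun p => edgeVector z p x, laplacian_mulVec_eq_sum]
      field_simp
    rw [hval]
    exact (convex_convexHull ℝ _).sum_mem
      (fun p _ => div_nonneg (G.weight_nonneg _ _) (by positivity)) hsum
      fun p hp => subset_convexHull ℝ _ ⟨p, (Finset.mem_filter.1 hp).2, rfl⟩
  -- The points obtained are affinely independent, which bounds their number by n + 1.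
  obtain ⟨ι, _, y, w, hy, hind, hw, hw1, hwy⟩ := eq_pos_convex_span_of_mem_convexHull hmem
  choose e he hey using fun i => hy (Set.mem_range_self i)
  set H := ofEdges e he (fun i => m * w i) fun i => mul_pos hG (hw i)
  have hcard : Fintype.card ι ≤ Fintype.card V + 1 := by
    simpa using hind.card_le_finrank_succ.trans
      (Nat.add_le_add_right (Submodule.finrank_le _) 1)
  have hL : H.laplacian.mulVec z = G.laplacian.mulVec z := by
    ext x
    rw [laplacian_mulVec_eq_sum, sum_sum_weight_ofEdges_mul _ _ _ _
      (fun u v => edgeVector z (u, v) x)]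
    · have := congrFun hwy x
      simp only [Finset.sum_apply, Pi.smul_apply, smul_eq_mul, ← hey] at this
      simp only [mul_assoc, ← Finset.mul_sum, Prod.mk.eta, this]
      field_simp
    · intro u v
      simp only [edgeVector, Pi.smul_apply, Pi.sub_apply, smul_eq_mul]
      ring
  refine ⟨H, ?_, (numEdges_ofEdges_le _ _ _ _).trans hcard, ?_⟩
  · have := sum_sum_weight_ofEdges_mul e he (fun i => m * w i) (fun i => mul_pos hG (hw i))
      (fun _ _ => 1) (fun _ _ => rfl)
    simp only [mul_one, ← Finset.mul_sum, hw1] at this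
    rw [totalWeight, this]
    ring
  · have : H.equilibrium s = z := by
      apply equilibrium_eq_of_add_laplacian_mulVec
      rw [hL, hz, G.equilibrium_add_laplacian_mulVec]
    rw [pdIndex_eq_dotProduct, pdIndex_eq_dotProduct, this]

end Sparsify

end WeightedGraph

/-! ### Near-optimal sparse connected graphs -/

section Optimal

variable {V : Type*} [Fintype V] [DecidableEq V]

theorem optimalIndex_le {m : ℝ} (s : V → ℝ) {G : WeightedGraph V} (hG : G ∈ feasibleGraphs V m) :
    optimalIndex m s ≤ G.pdIndex s :=
  csInf_le ⟨0, by rintro _ ⟨G, -, rfl⟩; exact G.pdIndex_nonneg s⟩ ⟨G, hG, rfl⟩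

theorem exists_star_mem_feasibleGraphs {m : ℝ} (h : (feasibleGraphs V m).Nonempty) :
    ∃ T ∈ feasibleGraphs V m, T.numEdges ≤ Fintype.card V := by
  obtain ⟨G, hG, hGm⟩ := h
  obtain ⟨r⟩ := hG.nonempty
  rcases subsingleton_or_nontrivial V with hV | hV
  · rw [G.totalWeight_eq_zero_of_subsingleton] at hGm
    -- On one vertex the star has no edges, so the weight 1 is immaterial.
    refine ⟨.star r 1 one_pos, ⟨WeightedGraph.star_connected _ _, ?_⟩,
      WeightedGraph.numEdges_star_le _ _⟩
    rw [WeightedGraph.totalWeight_eq_zero_of_subsingleton, hGm]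
  · have hm : 0 < m := hGm ▸ G.totalWeight_pos hG
    have hV : (0 : ℝ) < Fintype.card V - 1 := by
      rw [sub_pos]
      exact_mod_cast Fintype.one_lt_card
    refine ⟨.star r (m / (Fintype.card V - 1)) (by positivity),
      ⟨WeightedGraph.star_connected _ _, ?_⟩, WeightedGraph.numEdges_star_le _ _⟩
    rw [WeightedGraph.totalWeight_star]
    field_simp

/-- Up to a factor arbitrarily close to `1`, the optimal index is attained by a feasible graph with
at most `2 n + 1` edges. -/
theorem exists_sparse_pdIndex_le {m : ℝ} (h : (feasibleGraphs V m).Nonempty) (s : V → ℝ)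
    (hs : ∀ u v, (s u - s v) ^ 2 ≤ 1) {ε : ℝ} (hε : 0 < ε) :
    ∃ H ∈ feasibleGraphs V m, H.numEdges ≤ 2 * Fintype.card V + 1 ∧
      H.pdIndex s ≤ (1 + ε) * optimalIndex m s := by
  obtain ⟨T, hT, hTn⟩ := exists_star_mem_feasibleGraphs h
  have : Nonempty V := hT.1.nonempty
  set A := ∑ u, (s u - (∑ v, s v) / Fintype.card V) ^ 2 with hA
  rcases (Finset.sum_nonneg fun _ _ => sq_nonneg _ : 0 ≤ A).eq_or_lt with hA0 | hA0
  · have hc : s = fun _ => (∑ v, s v) / Fintype.card V := by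
      ext u
      have := (Finset.sum_eq_zero_iff_of_nonneg fun _ _ => sq_nonneg _).1 hA0.symm u
        (Finset.mem_univ u)
      exact sub_eq_zero.1 (pow_eq_zero_iff two_ne_zero |>.1 this)
    have h0 : ∀ G : WeightedGraph V, G.pdIndex s = 0 := fun G => by
      rw [hc, G.pdIndex_eq_zero_of_const]
    refine ⟨T, hT, by omega, ?_⟩
    have hopt : 0 ≤ optimalIndex m s :=
      le_csInf (h.image _) (by rintro _ ⟨G, -, rfl⟩; exact G.pdIndex_nonneg s)
    rw [h0]
    positivity
  · have hm : 0 ≤ m := hT.2 ▸ T.totalWeight_nonneg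
    have hopt : 0 < optimalIndex m s := by
      refine lt_of_lt_of_le (by positivity : 0 < A ^ 2 / (A + m)) (le_csInf (h.image _) ?_)
      rintro _ ⟨G, hG, rfl⟩
      rw [← hG.2]
      exact G.sq_div_le_pdIndex s hs hA hA0
    obtain ⟨_, ⟨G, hG, rfl⟩, hGlt⟩ := exists_lt_of_csInf_lt (h.image _)
      (show optimalIndex m s < (1 + ε) * optimalIndex m s by nlinarith)
    have hm0 : 0 < m := by
      rcases subsingleton_or_nontrivial V with hV | hV
      · have := uniqueOfSubsingleton (Classical.arbitrary V)
        simp at hA0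
      · exact hG.2 ▸ G.totalWeight_pos hG.1
    obtain ⟨H, hHm, hHn, hHs⟩ := G.exists_numEdges_le_pdIndex_eq (hG.2 ▸ hm0) s
    simp only [← hHs] at hGlt
    -- `H` may be disconnected; `t` is chosen so that the star's share of the index fits in the
    -- remaining slack.
    obtain ⟨t, ht0, ht1, ht⟩ : ∃ t : ℝ, 0 < t ∧ t < 1 ∧
        t * T.pdIndex s ≤ (1 + ε) * optimalIndex m s - H.pdIndex s := by
      have hTs := T.pdIndex_nonneg s
      set d := (1 + ε) * optimalIndex m s - H.pdIndex s with hd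
      have hd0 : 0 < d := sub_pos.2 hGlt
      refine ⟨d / (1 + d + T.pdIndex s), by positivity, ?_, ?_⟩
      · rw [div_lt_one (by positivity)]
        linarith
      · rw [div_mul_eq_mul_div, div_le_iff₀ (by positivity)]
        nlinarith
    refine ⟨.mix H T t ht0 ht1, ⟨H.mix_connected T ht0 ht1 hT.1, ?_⟩, ?_, ?_⟩
    · rw [WeightedGraph.totalWeight_mix, hHm, hG.2, hT.2]
      ring
    · have := H.numEdges_mix_le T ht0 ht1
      omega
    · have := H.pdIndex_mix_le T ht0 ht1 s
      nlinarith [mul_nonneg ht0.le (H.pdIndex_nonneg s)]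

end Optimal

theorem mainTheorem4 :
    ∃ C K : ℝ, 0 < C ∧ 0 < K ∧
      ∀ (n : ℕ) (m : ℝ) (s : Fin n → ℝ) (ε : ℝ),
        (feasibleGraphs (Fin n) m).Nonempty →
        (∀ u, s u ∈ Set.Icc (0 : ℝ) 1) →
        0 < ε → ε < 1 →
        ∃ H ∈ feasibleGraphs (Fin n) m,
          (H.numEdges : ℝ) ≤ C * (n / ε ^ 2) ∧
          optimalIndex m s ≤ H.pdIndex s ∧
          H.pdIndex s ≤ (1 + ε + K * ε ^ 2) * optimalIndex m s := by
  refine ⟨3, 1, by norm_num, one_pos, fun n m s ε h hs hε0 hε1 => ?_⟩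
  have hs' : ∀ u v, (s u - s v) ^ 2 ≤ 1 := fun u v => by
    rw [sq_le_one_iff_abs_le_one, abs_le]
    constructor <;> linarith [(hs u).1, (hs u).2, (hs v).1, (hs v).2]
  obtain ⟨H, hH, hHn, hHs⟩ := exists_sparse_pdIndex_le h s hs' (ε := ε + 1 * ε ^ 2) (by positivity)
  refine ⟨H, hH, ?_, optimalIndex_le s hH, by rwa [← add_assoc] at hHs⟩
  -- Needed to absorb the additive 1: 2n + 1 ≤ 3n.
  have hn : 1 ≤ n := Fin.pos_iff_nonempty.2 hH.1.nonempty
  have hn' : (H.numEdges : ℝ) ≤ 3 * n := by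
    rw [Fintype.card_fin] at hHn
    exact_mod_cast (by omega : H.numEdges ≤ 3 * n)
  refine hn'.trans (mul_le_mul_of_nonneg_left ?_ (by norm_num))
  exact le_div_self (Nat.cast_nonneg n) (by positivity) (pow_le_one₀ hε0.le hε1.le)
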